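/- Let $(\mathcal C,\otimes,1)$ be a small semicartesian monoidal category (the unit $1$ is terminal), with projections $\pi_1\colon A\otimes B\to A\otimes 1\cong A$ and $\pi_2\colon A\otimes B\to 1\otimes B\cong B$. Assume that $\mathcal C$ has pseudo-pullbacks: for all $f\colon A\to U$ and $g\colon B\to U$ the pair $f\circ\pi_1,\ g\circ\pi_2\colon A\otimes B\rightrightarrows U$ has an equalizer $e\colon A\,{}_f\!\otimes_g B\to A\otimes B$; write $p_1=\pi_1\circ e$ and $p_2=\pi_2\circ e$. A *Grothendieck prelopology* $L$ on $\mathcal C$ assigns to each object $U$ a collection $L(U)$ of small families $\{f_i\colon U_i\to U\}_{i\in I}$ such that: (1) $\{f\colon U'\to U\}\in L(U)$ for every isomorphism $f$; (2) if $\{f_i\colon U_i\to U\}_{i\in I}\in L(U)$ and $\{g_{ij}\colon V_{ij}\to U_i\}_{j\in J_i}\in L(U_i)$ for all $i$, then $\{f_i\circ g_{ij}\colon V_{ij}\to U\}_{i\in I,\,j\in J_i}\in L(U)$; (3) if $\{f_i\colon U_i\to U\}_{i\in I}\in L(U)$ and $V$ is an object, then $\{f_i\otimes \mathrm{id}_V\}_{i\in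 I}\in L(U\otimes V)$ and $\{\mathrm{id}_V\otimes f_i\}_{i\in I}\in L(V\otimes U)$; (4) if $\{f_i\colon U_i\to U\}_{i\in I}\in L(U)$ and $g\colon V\to U$ is a morphism, then the families of induced morphisms $\{U_i\,{}_{f_i}\!\otimes_g V\to U\,{}_{\mathrm{id}_U}\!\otimes_g V\}_{i\in I}$ and $\{V\,{}_g\!\otimes_{f_i} U_i\to V\,{}_g\!\otimes_{\mathrm{id}_U} U\}_{i\in I}$ belong to $L(U\,{}_{\mathrm{id}_U}\!\otimes_g V)$ and $L(V\,{}_g\!\otimes_{\mathrm{id}_U} U)$ respectively. A presheaf $F\colon\mathcal C^{op}\to \mathbf{Set}$ is an *$L$-sheaf* if for every $\{f_i\colon U_i\to U\}_{i\in I}\in L(U)$ and every family $x_i\in F(U_i)$ with $F(p_1)(x_i)=F(p_2)(x_j)$ in $F(U_i\,{}_{f_i}\!\otimes_{f_j}U_j)$ for all $i,j\in I$, there is a unique $x\in F(U)$ with $F(f_i)(x)=x_i$ for all $i\in I$. Let $Sh(\mathcal C,L)$ be the full subcategory of $PSh(\mathcal C)$ on the $L$-sheaves, and let the sheafification functor $a\colon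 PSh(\mathcal C)\to Sh(\mathcal C,L)$ be the left adjoint of the inclusion (it exists and is unique up to isomorphism). **Proposition.** For every Grothendieck prelopology $L$ on $\mathcal C$, the terminal presheaf is an $L$-sheaf, and $a\colon PSh(\mathcal C)\to Sh(\mathcal C,L)$ preserves the terminal object: $a$ sends a terminal presheaf to a terminal object of $Sh(\mathcal C,L)$. -/

import Mathlib

open CategoryTheory CategoryTheory.Limits Opposite MonoidalCategory

universe u

namespace PrelopologySheaf

/-- A set of objects in a locally presentable category is `κ`-presentable for some `κ`. -/
theorem exists_common_cardinal {C : Type u} [SmallCategory C] {ι : Type u} (X : ι → Cᵒᵖ ⥤ Type u) :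
    ∃ (κ : Cardinal.{u}) (_ : Fact κ.IsRegular), ∀ i, IsCardinalPresentable (X i) κ := by
  have h (i : ι) : ∃ (κ : Cardinal.{u}) (_ : Fact κ.IsRegular), IsCardinalPresentable (X i) κ :=
    (inferInstance : IsPresentable.{u} (X i)).exists_cardinal
  choose κ hκ hX using h
  have hreg : (Order.succ (max Cardinal.aleph0 (⨆ i, κ i))).IsRegular :=
    Cardinal.isRegular_succ (le_max_left _ _)
  have : Fact (Order.succ (max Cardinal.aleph0 (⨆ i, κ i))).IsRegular := ⟨hreg⟩
  refine ⟨_, this, fun i => isCardinalPresentable_of_le (κ := κ i) _ ?_⟩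
  exact (le_ciSup (Cardinal.bddAbove_of_small) i).trans
    ((le_max_right _ _).trans (Order.le_succ _))

section PseudoPullback

variable {C : Type u} [SmallCategory C] [SemiCartesianMonoidalCategory C]

open SemiCartesianMonoidalCategory

variable (C) in
/-- A semicartesian monoidal category has pseudo-pullbacks if, for all `f : A ⟶ U` and
`g : B ⟶ U`, the pair `π₁ ≫ f, π₂ ≫ g : A ⊗ B ⟶ U` has an equalizer. -/
class HasPseudoPullbacks : Prop where
  hasEqualizer {A B U : C} (f : A ⟶ U) (g : B ⟶ U) :
    HasEqualizer (fst A B ≫ f) (snd A B ≫ g)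

attribute [instance] HasPseudoPullbacks.hasEqualizer

instance [HasEqualizers C] : HasPseudoPullbacks C where
  hasEqualizer _ _ := inferInstance

namespace pseudoPullback

theorem tensorHom_fst {A A' B B' : C} (a : A ⟶ A') (b : B ⟶ B') :
    (a ⊗ₘ b) ≫ fst A' B' = fst A B ≫ a := by
  have h : b ≫ isTerminalTensorUnit.from B' = isTerminalTensorUnit.from B :=
    isTerminalTensorUnit.hom_ext _ _
  rw [fst_def, fst_def, MonoidalCategory.tensorHom_def, Category.assoc, Category.assoc,
    ← MonoidalCategory.whiskerLeft_comp_assoc, h, ← MonoidalCategory.whisker_exchange_assoc,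
    MonoidalCategory.rightUnitor_naturality]

theorem tensorHom_snd {A A' B B' : C} (a : A ⟶ A') (b : B ⟶ B') :
    (a ⊗ₘ b) ≫ snd A' B' = snd A B ≫ b := by
  have h : a ≫ isTerminalTensorUnit.from A' = isTerminalTensorUnit.from A :=
    isTerminalTensorUnit.hom_ext _ _
  rw [snd_def, snd_def, MonoidalCategory.tensorHom_def', Category.assoc, Category.assoc,
    ← MonoidalCategory.comp_whiskerRight_assoc, h, MonoidalCategory.whisker_exchange_assoc,
    MonoidalCategory.leftUnitor_naturality]

end pseudoPullback

variable [HasPseudoPullbacks C]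

/-- The pseudo-pullback of `f : A ⟶ U` and `g : B ⟶ U`. -/
noncomputable def pseudoPullback {A B U : C} (f : A ⟶ U) (g : B ⟶ U) : C :=
  equalizer (fst A B ≫ f) (snd A B ≫ g)

namespace pseudoPullback

/-- The equalizer arrow into the tensor product. -/
noncomputable def ι {A B U : C} (f : A ⟶ U) (g : B ⟶ U) : pseudoPullback f g ⟶ A ⊗ B :=
  equalizer.ι (fst A B ≫ f) (snd A B ≫ g)

/-- The first projection of the pseudo-pullback. -/
noncomputable def p₁ {A B U : C} (f : A ⟶ U) (g : B ⟶ U) : pseudoPullback f g ⟶ A :=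
  ι f g ≫ fst A B

/-- The second projection of the pseudo-pullback. -/
noncomputable def p₂ {A B U : C} (f : A ⟶ U) (g : B ⟶ U) : pseudoPullback f g ⟶ B :=
  ι f g ≫ snd A B

theorem condition {A B U : C} (f : A ⟶ U) (g : B ⟶ U) : p₁ f g ≫ f = p₂ f g ≫ g := by
  rw [p₁, p₂, Category.assoc, Category.assoc]
  exact equalizer.condition (fst A B ≫ f) (snd A B ≫ g)

/-- The morphism between pseudo-pullbacks over the same base induced by `a ⊗ b`: the unique one
with `map ≫ ι f' g' = ι f g ≫ (a ⊗ₘ b)`. -/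
noncomputable def map {A A' B B' U : C} {f : A ⟶ U} {g : B ⟶ U} {f' : A' ⟶ U} {g' : B' ⟶ U}
    (a : A ⟶ A') (b : B ⟶ B') (ha : a ≫ f' = f) (hb : b ≫ g' = g) :
    pseudoPullback f g ⟶ pseudoPullback f' g' :=
  equalizer.lift (ι f g ≫ (a ⊗ₘ b)) (by
    have h := condition f g
    simp only [p₁, p₂, Category.assoc] at h
    rw [Category.assoc, Category.assoc, ← Category.assoc (a ⊗ₘ b),
      ← Category.assoc (a ⊗ₘ b), tensorHom_fst, tensorHom_snd, Category.assoc, Category.assoc,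
      ha, hb, h])

end pseudoPullback

end PseudoPullback

/-- A Grothendieck prelopology: `covers X f` says that the family `{f i : X i ⟶ U}_{i ∈ I}`
belongs to `L(U)`. -/
structure GrothendieckPrelopology (C : Type u) [SmallCategory C] [SemiCartesianMonoidalCategory C]
    [HasPseudoPullbacks C] where
  covers : ∀ {U : C} {I : Type u} (X : I → C) (_ : ∀ i, X i ⟶ U), Prop
  iso : ∀ {U U' : C} (f : U' ⟶ U), IsIso f →
    covers (fun _ : PUnit.{u + 1} => U') (fun _ => f)
  comp : ∀ {U : C} {I : Type u} (X : I → C) (f : ∀ i, X i ⟶ U) {J : I → Type u}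
    (Y : ∀ i, J i → C) (g : ∀ i j, Y i j ⟶ X i),
    covers X f → (∀ i, covers (Y i) (g i)) →
    covers (fun k : (Σ i, J i) => Y k.1 k.2) (fun k => g k.1 k.2 ≫ f k.1)
  tensor_right : ∀ {U : C} {I : Type u} (X : I → C) (f : ∀ i, X i ⟶ U) (V : C),
    covers X f → covers (fun i => X i ⊗ V) (fun i => f i ▷ V)
  tensor_left : ∀ {U : C} {I : Type u} (X : I → C) (f : ∀ i, X i ⟶ U) (V : C),
    covers X f → covers (fun i => V ⊗ X i) (fun i => V ◁ f i)
  pseudoPullback_right : ∀ {U : C} {I : Type u} (X : I → C) (f : ∀ i, X i ⟶ U) {V : C}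
    (g : V ⟶ U), covers X f →
    covers (U := pseudoPullback (𝟙 U) g) (fun i => pseudoPullback (f i) g)
      (fun i => pseudoPullback.map (f i) (𝟙 V) (Category.comp_id _) (Category.id_comp _))
  pseudoPullback_left : ∀ {U : C} {I : Type u} (X : I → C) (f : ∀ i, X i ⟶ U) {V : C}
    (g : V ⟶ U), covers X f →
    covers (U := pseudoPullback g (𝟙 U)) (fun i => pseudoPullback g (f i))
      (fun i => pseudoPullback.map (𝟙 V) (f i) (Category.id_comp _) (Category.comp_id _))

variable {C : Type u} [SmallCategory C] [SemiCartesianMonoidalCategory C] [HasPseudoPullbacks C]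

/-- Compatible families for `{f i : X i ⟶ U}`. -/
def Compatible (F : Cᵒᵖ ⥤ Type u) {U : C} {I : Type u} (X : I → C) (f : ∀ i, X i ⟶ U)
    (x : ∀ i, F.obj (op (X i))) : Prop :=
  ∀ i j, F.map (pseudoPullback.p₁ (f i) (f j)).op (x i) =
    F.map (pseudoPullback.p₂ (f i) (f j)).op (x j)

/-- Every compatible family for `{f i : X i ⟶ U}` has a unique gluing. -/
def IsSheafFor (F : Cᵒᵖ ⥤ Type u) {U : C} {I : Type u} (X : I → C) (f : ∀ i, X i ⟶ U) : Prop :=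
  ∀ x : ∀ i, F.obj (op (X i)), Compatible F X f x →
    ∃! t : F.obj (op U), ∀ i, F.map (f i).op t = x i

namespace GrothendieckPrelopology

variable (L : GrothendieckPrelopology C)

/-- The property of being a sheaf for `L`, on presheaves of sets. -/
def IsSheaf : ObjectProperty (Cᵒᵖ ⥤ Type u) := fun F =>
  ∀ ⦃U : C⦄ ⦃I : Type u⦄ (X : I → C) (f : ∀ i, X i ⟶ U), L.covers X f → IsSheafFor F X f

/-- The category `Sh(C, L)`, a full subcategory of presheaves. -/
abbrev Sheaves : Type (u + 1) := L.IsSheaf.FullSubcategory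

/-- The inclusion of sheaves in presheaves. -/
abbrev inclusion : L.Sheaves ⥤ (Cᵒᵖ ⥤ Type u) := L.IsSheaf.ι

end GrothendieckPrelopology

/-! The sheaf condition says that a presheaf is local with respect to `S ⟶ y(U)`, where `S` is
the coequalizer of `∐ y(X i ⊗_U X j) ⇉ ∐ y(X i)`. -/

section Reflection

/-- The diagram whose colimit is the sieve of a family. -/
noncomputable def sieveIndex {U : C} {I : Type u} (X : I → C) (f : ∀ i, X i ⟶ U) :
    MultispanIndex (MultispanShape.prod I) (Cᵒᵖ ⥤ Type u) where
  left p := yoneda.obj (pseudoPullback (f p.1) (f p.2))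
  right i := yoneda.obj (X i)
  fst p := yoneda.map (pseudoPullback.p₁ (f p.1) (f p.2))
  snd p := yoneda.map (pseudoPullback.p₂ (f p.1) (f p.2))

/-- The canonical morphism from the sieve of a family to the representable presheaf. -/
noncomputable def sieveHom {U : C} {I : Type u} (X : I → C) (f : ∀ i, X i ⟶ U) :
    multicoequalizer (sieveIndex X f) ⟶ yoneda.obj U :=
  Multicoequalizer.desc (sieveIndex X f) _ (fun i => yoneda.map (f i)) (fun p => by
    change yoneda.map (pseudoPullback.p₁ (f p.1) (f p.2)) ≫ yoneda.map (f p.1) =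
      yoneda.map (pseudoPullback.p₂ (f p.1) (f p.2)) ≫ yoneda.map (f p.2)
    rw [← Functor.map_comp, ← Functor.map_comp]
    exact congrArg _ (pseudoPullback.condition (f p.1) (f p.2)))

theorem bijective_sieveHom_iff (F : Cᵒᵖ ⥤ Type u) {U : C} {I : Type u} (X : I → C)
    (f : ∀ i, X i ⟶ U) :
    Function.Bijective (fun g : yoneda.obj U ⟶ F => sieveHom X f ≫ g) ↔ IsSheafFor F X f := by
  have key (t : F.obj (op U)) (i : I) :
      (Multicoequalizer.π (sieveIndex X f) i ≫ sieveHom X f ≫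
          (yonedaEquiv.symm t : yoneda.obj U ⟶ F) : yoneda.obj (X i) ⟶ F) =
        yonedaEquiv.symm (F.map (f i).op t) := by
    rw [← yonedaEquiv_symm_naturality_left]
    refine (Category.assoc _ _ _).symm.trans ?_
    exact congrArg (· ≫ (yonedaEquiv.symm t : yoneda.obj U ⟶ F))
      (Multicoequalizer.π_desc (sieveIndex X f) _ _ _ i)
  rw [Function.bijective_iff_existsUnique]
  constructor
  · intro h x hx
    obtain ⟨g, hg, hu⟩ := h (Multicoequalizer.desc (sieveIndex X f) F
      (fun i => yonedaEquiv.symm (x i)) (fun p => by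
        change yoneda.map (pseudoPullback.p₁ (f p.1) (f p.2)) ≫ yonedaEquiv.symm (x p.1) =
          yoneda.map (pseudoPullback.p₂ (f p.1) (f p.2)) ≫ yonedaEquiv.symm (x p.2)
        rw [yonedaEquiv_symm_naturality_left, yonedaEquiv_symm_naturality_left]
        exact congrArg _ (hx p.1 p.2)))
    obtain ⟨t, rfl⟩ := yonedaEquiv.symm.surjective g
    refine ⟨t, fun i => ?_, fun s hs => ?_⟩
    · apply yonedaEquiv.symm.injective
      rw [← key]
      exact (congrArg (Multicoequalizer.π (sieveIndex X f) i ≫ ·) hg).trans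
        (Multicoequalizer.π_desc _ _ _ _ _)
    · apply yonedaEquiv.symm.injective
      refine hu _ (Multicoequalizer.hom_ext _ _ _ fun i => ?_)
      refine (key s i).trans ?_
      rw [hs i]
      exact (Multicoequalizer.π_desc (sieveIndex X f) F (fun i => yonedaEquiv.symm (x i)) _ i).symm
  · intro h b
    have hb (p : I × I) := Multicoequalizer.condition (sieveIndex X f) p
    obtain ⟨t, ht, hu⟩ := h
      (fun i => yonedaEquiv (Multicoequalizer.π (sieveIndex X f) i ≫ b)) (fun i j => by
        rw [yonedaEquiv_naturality, yonedaEquiv_naturality]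
        have := congrArg (· ≫ b) (hb (i, j))
        simp only [Category.assoc] at this
        exact congrArg _ this)
    refine ⟨yonedaEquiv.symm t, Multicoequalizer.hom_ext _ _ _ fun i => ?_, fun g hg => ?_⟩
    · refine (key t i).trans ?_
      rw [ht i]
      exact yonedaEquiv.symm_apply_apply _
    · obtain ⟨s, rfl⟩ := yonedaEquiv.symm.surjective g
      refine congrArg _ (hu s fun i => ?_)
      apply yonedaEquiv.symm.injective
      rw [← key]
      refine (congrArg (Multicoequalizer.π (sieveIndex X f) i ≫ ·) hg).trans ?_
      exact (yonedaEquiv.symm_apply_apply _).symm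

/-- The members of a family, and those occurring more than once. -/
def supp {U : C} {I : Type u} (f : I → Over U) : Set (Over U) × Set (Over U) :=
  (Set.range f, {o | ∃ a b, a ≠ b ∧ f a = o ∧ f b = o})

/-- The sheaf condition depends only on `supp`, so a small set of families suffices. -/
theorem isSheafFor_of_supp_eq (F : Cᵒᵖ ⥤ Type u) {U : C} {I J : Type u} (f : I → Over U)
    (g : J → Over U) (h : supp f = supp g)
    (hf : IsSheafFor F (fun i => (f i).left) (fun i => (f i).hom)) :
    IsSheafFor F (fun j => (g j).left) (fun j => (g j).hom) := by
  classical
  intro x hx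
  have h₁ : Set.range f = Set.range g := congrArg Prod.fst h
  have h₂ := congrArg Prod.snd h
  have hsub (α : I → J) (hα : ∀ i, g (α i) = f i) :
      ∃! t : F.obj (op U), ∀ i, F.map (g (α i)).hom.op t = x (α i) := by
    obtain rfl : g ∘ α = f := funext hα
    exact hf (fun i => x (α i)) (fun i j => hx (α i) (α j))
  have hα₀ (i : I) : ∃ j, g j = f i := by
    have : f i ∈ Set.range g := h₁ ▸ Set.mem_range_self i
    exact this
  choose α hα using hα₀
  have heq {o o' : Over U} (e : o = o') (t : F.obj (op U)) :
      HEq (F.map o.hom.op t) (F.map o'.hom.op t) := by subst e; rfl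
  have hrep (j k : J) (e : g j = g k) : HEq (x j) (x k) := by
    by_cases hjk : j = k
    · subst hjk; rfl
    have : g k ∈ (supp g).2 := ⟨j, k, hjk, e, rfl⟩
    rw [← h] at this
    obtain ⟨a, b, hab, ha, hb⟩ := this
    obtain ⟨t, ht, -⟩ := hsub (Function.update (Function.update α b k) a j) (fun i => by
      by_cases hia : i = a
      · subst hia; simp [e, ha]
      · by_cases hib : i = b
        · subst hib; simp [hia, hb]
        · simp [hia, hib, hα])
    have ta := ht a
    have tb := ht b
    rw [Function.update_self] at ta
    rw [Function.update_of_ne hab.symm, Function.update_self] at tb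
    rw [← ta, ← tb]
    exact heq e t
  obtain ⟨t, ht, hu⟩ := hsub α hα
  refine ⟨t, fun j => ?_, fun s hs => hu s fun i => hs (α i)⟩
  have : g j ∈ Set.range f := h₁ ▸ Set.mem_range_self j
  obtain ⟨i, hi⟩ := this
  have e : g (α i) = g j := (hα i).trans hi
  exact eq_of_heq ((heq e.symm t).trans ((heq_of_eq (ht i)).trans (hrep _ _ e)))

instance isRightAdjoint_inclusion (L : GrothendieckPrelopology C) :
    L.inclusion.IsRightAdjoint := by
  let P (U : C) (I : Type u) (f : I → Over U) : Prop :=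
    L.covers (fun i => (f i).left) (fun i => (f i).hom)
  let T : Type u := {d : Σ U : C, Set (Over U) × Set (Over U) //
    ∃ (I : Type u) (f : I → Over d.1), P d.1 I f ∧ supp f = d.2}
  choose I f hf hd using fun d : T => d.2
  let m (d : T) := sieveHom (fun i => (f d i).left) (fun i => (f d i).hom)
  let W : MorphismProperty (Cᵒᵖ ⥤ Type u) := MorphismProperty.ofHoms m
  have hW : L.IsSheaf = W.isLocal := by
    ext F
    constructor
    · rintro hF _ _ _ ⟨d⟩
      exact (bijective_sieveHom_iff F _ _).2 (hF _ _ (hf d))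
    · intro hF U J X g hg
      let d : T := ⟨⟨U, supp (fun j => Over.mk (g j))⟩, J, fun j => Over.mk (g j), hg, rfl⟩
      exact isSheafFor_of_supp_eq F (f d) (fun j => Over.mk (g j)) (hd d)
        ((bijective_sieveHom_iff F _ _).1 (hF _ ⟨d⟩))
  obtain ⟨κ, _, hκ⟩ := exists_common_cardinal (C := C)
    (Sum.elim (fun d : T => multicoequalizer
      (sieveIndex (fun i => (f d i).left) (fun i => (f d i).hom)))
      (fun d : T => yoneda.obj d.1.1))
  suffices h : W.isLocal.ι.IsRightAdjoint by
    have aux (Q : ObjectProperty (Cᵒᵖ ⥤ Type u)) (e : Q = W.isLocal) : Q.ι.IsRightAdjoint := by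
      subst e; exact h
    exact aux _ hW
  refine W.isRightAdjoint_ι_isLocal κ ?_
  rintro _ _ _ ⟨d⟩
  exact ⟨hκ (Sum.inl d), hκ (Sum.inr d)⟩

end Reflection

/-- The sheafification functor `a : PSh(C) ⥤ Sh(C, L)`: the left adjoint of the inclusion. -/
noncomputable def GrothendieckPrelopology.sheafification (L : GrothendieckPrelopology C) :
    (Cᵒᵖ ⥤ Type u) ⥤ L.Sheaves :=
  L.inclusion.leftAdjoint

/-- Sheafification is left adjoint to the inclusion of sheaves in presheaves. -/
noncomputable def GrothendieckPrelopology.sheafificationAdjunction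
    (L : GrothendieckPrelopology C) : L.sheafification ⊣ L.inclusion :=
  Adjunction.ofIsRightAdjoint L.inclusion

end PrelopologySheaf

/-! Limits of presheaves are computed pointwise, so a terminal presheaf has singleton values, and
gluing into singletons is automatic: this is `isSheaf_of_unique`, transferred to terminal presheaves
by `isSheaf_of_isTerminal`. Hence the terminal presheaf is the underlying presheaf of a sheaf `S`.
As sheaves form a full subcategory, `S` is also terminal among sheaves. Sheafification is a
reflection onto that subcategory, so it returns any sheaf unchanged up to the counit isomorphism.
Applied to `S`, this says that the sheafification of the terminal presheaf is terminal. No exactness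
of sheafification is involved: a reflector preserves the terminal object as soon as that object lies
in the subcategory. -/

open PrelopologySheaf in
/-- A presheaf whose values are all singletons is a sheaf for every prelopology. -/
theorem PrelopologySheaf.GrothendieckPrelopology.isSheaf_of_unique {C : Type u} [SmallCategory C]
    [SemiCartesianMonoidalCategory C] [HasPseudoPullbacks C] (L : GrothendieckPrelopology C)
    (T : Cᵒᵖ ⥤ Type u) (hT : ∀ U, Nonempty (Unique (T.obj U))) : L.IsSheaf T := by
  intro U I X f _ x _
  obtain ⟨_⟩ := hT (op U)
  -- Uniqueness comes from `T.obj (op U)` itself being a singleton, so the empty family is covered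
  -- too.
  refine ⟨default, fun i => ?_, fun _ _ => Subsingleton.elim _ _⟩
  obtain ⟨_⟩ := hT (op (X i))
  exact Subsingleton.elim _ _

open PrelopologySheaf in
/-- A terminal presheaf is a sheaf for every prelopology. -/
theorem PrelopologySheaf.GrothendieckPrelopology.isSheaf_of_isTerminal {C : Type u}
    [SmallCategory C] [SemiCartesianMonoidalCategory C] [HasPseudoPullbacks C]
    (L : GrothendieckPrelopology C) {T : Cᵒᵖ ⥤ Type u} (hT : IsTerminal T) : L.IsSheaf T :=
  L.isSheaf_of_unique T fun U =>
    -- Evaluation at `U` preserves limits, and terminal objects of `Type u` are the singletons.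
    ⟨Types.isTerminalEquivUnique _ (hT.isTerminalObj ((evaluation _ _).obj U) T)⟩

theorem mainTheorem11 {C : Type u} [SmallCategory C] [SemiCartesianMonoidalCategory C]
    [PrelopologySheaf.HasPseudoPullbacks C]
    (L : PrelopologySheaf.GrothendieckPrelopology C) :
    (∀ T : Cᵒᵖ ⥤ Type u, Nonempty (IsTerminal T) → L.IsSheaf T) ∧
      PreservesLimit (Functor.empty.{0} (Cᵒᵖ ⥤ Type u)) L.sheafification := by
  refine ⟨fun T ⟨hT⟩ => L.isSheaf_of_isTerminal hT, ?_⟩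
  -- With this choice `L.inclusion.obj S` is `⊤_ _` by definition, so the counit at `S` starts at
  -- the sheafification of `⊤_ _`.
  let S : L.Sheaves := ⟨⊤_ _, L.isSheaf_of_isTerminal terminalIsTerminal⟩
  -- A fully faithful functor reflects terminal objects.
  have hS : IsTerminal S := IsTerminal.isTerminalOfObj L.inclusion S terminalIsTerminal
  have : HasTerminal L.Sheaves := hS.hasTerminal
  -- The counit is invertible because the right adjoint is fully faithful.
  have : IsIso L.sheafificationAdjunction.counit := inferInstance
  -- Terminal objects are unique up to isomorphism, so a single isomorphism from the image of `⊤_ _`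
  -- to the terminal sheaf is enough.
  exact preservesTerminal_of_iso L.sheafification
    (asIso (L.sheafificationAdjunction.counit.app S) ≪≫ hS.uniqueUpToIso terminalIsTerminal)
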